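/- Let $V_1\cong\mathbb{C}^2$ be the space of complex binary linear forms with the natural action $(g\cdot f)(v)=f(g^{-1}v)$ of $SL_2=SL_2(\mathbb{C})$, let $nV_1$ be the direct sum of $n$ copies of $V_1$, and let $SL_2$ act on $\mathbb{C}^2$ by the standard representation. Let $\mathcal{I}_n=\mathbb{C}[nV_1]^{SL_2}$ and $\mathcal{C}_n=\mathbb{C}[nV_1\oplus\mathbb{C}^2]^{SL_2}$ be the algebras of joint invariants and of joint covariants of $n$ binary linear forms. Let $(\mathcal{I}_n)_j$ and $(\mathcal{C}_n)_j$ be the subspaces of elements that are homogeneous of degree $j$ in the coefficients of the $n$ forms (for covariants, the degree in the coordinates of $\mathbb{C}^2$ is not counted). For every $n\ge 0$ all these subspaces are finite-dimensional, and the Poincaré series $$\mathcal{P}(\mathcal{I}_n,z)=\sum_{j\ge 0}\dim(\mathcal{I}_n)_j\,z^j,\qquad \mathcal{P}(\mathcal{C}_n,z)=\sum_{j\ge 0}\dim(\mathcal{C}_n)_j\,z^j$$ satisfy the following identities of formal power series, where $$N_m(z)=\sum_{k=1}^{m}\frac1k\binom{m-1}{k-1}\binom{m}{k-1}z^{k-1},\qquad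 W_m(z)=\sum_{k=0}^{m}\binom{m}{k}^2z^k$$ are the Narayana polynomials and the Narayana polynomials of type B. (i) For every integer $n\ge 3$, $$\mathcal{P}(\mathcal{I}_n,z)=\frac{\sum_{k=1}^{n-2}\frac1k\binom{n-3}{k-1}\binom{n-2}{k-1}z^{2k-2}}{(1-z^2)^{2n-3}}=\frac{N_{n-2}(z^2)}{(1-z^2)^{2n-3}}.$$ (ii) For every integer $n\ge 2$, $$\mathcal{P}(\mathcal{C}_n,z)=\frac{\sum_{k=0}^{n-1}\binom{n-1}{k}^2z^{2k}+\sum_{k=0}^{n-2}\binom{n-2}{k}\binom{n}{k+1}z^{2k+1}}{(1-z^2)^{2n-1}}=\frac{W_{n-1}(z^2)+n\,z\,N_{n-1}(z^2)}{(1-z^2)^{2n-1}}.$$ -/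

import Mathlib

open scoped Matrix MatrixGroups

noncomputable section

namespace BinaryForms

/-- A binary linear form `a 0 * x + a 1 * y`, recorded by its pair of coefficients. The space
`V₁` of binary linear forms is the space of these pairs. -/
abbrev LinearForm : Type := Fin 2 → ℂ

/-- The value of the binary linear form `a` at the vector `v`. -/
def LinearForm.value (a : LinearForm) (v : Fin 2 → ℂ) : ℂ := a ⬝ᵥ v

/-- The natural action of `SL₂(ℂ)` on linear forms, `(g • f)(v) = f (g⁻¹ v)`, on coefficients. -/
def LinearForm.act (g : SL(2, ℂ)) (a : LinearForm) : LinearForm :=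
  a ᵥ* ((g⁻¹ : SL(2, ℂ)) : Matrix (Fin 2) (Fin 2) ℂ)

/-- `LinearForm.act` is the action by inverse substitution. -/
theorem LinearForm.value_act (g : SL(2, ℂ)) (a : LinearForm) (v : Fin 2 → ℂ) :
    (a.act g).value v = a.value (((g⁻¹ : SL(2, ℂ)) : Matrix (Fin 2) (Fin 2) ℂ) *ᵥ v) := by
  simp only [LinearForm.value, LinearForm.act, Matrix.dotProduct_mulVec]

/-- The value of a polynomial `F ∈ ℂ[n V₁]` at an `n`-tuple of linear forms; the variable `(i, s)`
is the `s`-th coefficient of the `i`-th form. -/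
def evalForms {n : ℕ} (f : Fin n → LinearForm) (F : MvPolynomial (Fin n × Fin 2) ℂ) : ℂ :=
  MvPolynomial.eval (fun p => f p.1 p.2) F

/-- The value of a polynomial `F ∈ ℂ[n V₁ ⊕ ℂ²]` at an `n`-tuple of linear forms and a vector. -/
def evalFormsVec {n : ℕ} (f : Fin n → LinearForm) (v : Fin 2 → ℂ)
    (F : MvPolynomial ((Fin n × Fin 2) ⊕ Fin 2) ℂ) : ℂ :=
  MvPolynomial.eval (Sum.elim (fun p => f p.1 p.2) v) F

/-- The algebra `𝓘ₙ = ℂ[n V₁]^{SL₂}` of joint invariants of `n` binary linear forms. -/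
def jointInvariants (n : ℕ) : Subalgebra ℂ (MvPolynomial (Fin n × Fin 2) ℂ) where
  carrier := {F | ∀ (g : SL(2, ℂ)) (f : Fin n → LinearForm),
    evalForms (fun i => (f i).act g) F = evalForms f F}
  mul_mem' := fun hF hG g f => by
    have h1 := hF g f
    have h2 := hG g f
    simp only [evalForms, map_mul] at *
    rw [h1, h2]
  add_mem' := fun hF hG g f => by
    have h1 := hF g f
    have h2 := hG g f
    simp only [evalForms, map_add] at *
    rw [h1, h2]
  algebraMap_mem' := fun c g f => by
    simp [evalForms, MvPolynomial.algebraMap_eq]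

/-- The algebra `𝓒ₙ = ℂ[n V₁ ⊕ ℂ²]^{SL₂}` of joint covariants of `n` binary linear forms, where
`SL₂` acts on `ℂ²` by the standard representation. -/
def jointCovariants (n : ℕ) : Subalgebra ℂ (MvPolynomial ((Fin n × Fin 2) ⊕ Fin 2) ℂ) where
  carrier := {F | ∀ (g : SL(2, ℂ)) (f : Fin n → LinearForm) (v : Fin 2 → ℂ),
    evalFormsVec (fun i => (f i).act g) ((g : Matrix (Fin 2) (Fin 2) ℂ) *ᵥ v) F
      = evalFormsVec f v F}
  mul_mem' := fun hF hG g f v => by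
    have h1 := hF g f v
    have h2 := hG g f v
    simp only [evalFormsVec, map_mul] at *
    rw [h1, h2]
  add_mem' := fun hF hG g f v => by
    have h1 := hF g f v
    have h2 := hG g f v
    simp only [evalFormsVec, map_add] at *
    rw [h1, h2]
  algebraMap_mem' := fun c g f v => by
    simp [evalFormsVec, MvPolynomial.algebraMap_eq]

/-- The component `(𝓘ₙ)ⱼ` of joint invariants that are homogeneous of degree `j`. -/
def invariantsOfDegree (n j : ℕ) : Submodule ℂ (MvPolynomial (Fin n × Fin 2) ℂ) :=
  Subalgebra.toSubmodule (jointInvariants n) ⊓ MvPolynomial.homogeneousSubmodule (Fin n × Fin 2) ℂ j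

/-- The component `(𝓒ₙ)ⱼ` of joint covariants of degree `j`. The degree of a covariant is its
degree in the coefficients of the forms; the degree in the two coordinates of `ℂ²` is its order,
which does not count (weight `0`). -/
def covariantsOfDegree (n j : ℕ) : Submodule ℂ (MvPolynomial ((Fin n × Fin 2) ⊕ Fin 2) ℂ) :=
  Subalgebra.toSubmodule (jointCovariants n) ⊓
    MvPolynomial.weightedHomogeneousSubmodule ℂ
      (Sum.elim (fun _ => 1) (fun _ => 0) : (Fin n × Fin 2) ⊕ Fin 2 → ℕ) j

/-- The Poincaré series `∑ⱼ dim (Aⱼ) zʲ` of a sequence of (finite-dimensional) components. -/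
def poincareSeries {M : Type} [AddCommGroup M] [Module ℂ M] (A : ℕ → Submodule ℂ M) :
    PowerSeries ℚ :=
  PowerSeries.mk fun j => (Module.finrank ℂ (A j) : ℚ)

/-- The Narayana polynomial `Nₙ`. -/
def narayana (n : ℕ) : Polynomial ℚ :=
  ∑ k ∈ Finset.Icc 1 n,
    Polynomial.C ((1 / (k : ℚ)) * ((n - 1).choose (k - 1) : ℚ) * (n.choose (k - 1) : ℚ)) *
      Polynomial.X ^ (k - 1)

/-- The Narayana polynomial `Wₙ` of type B. -/
def narayanaB (n : ℕ) : Polynomial ℚ :=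
  ∑ k ∈ Finset.range (n + 1), Polynomial.C ((n.choose k : ℚ) ^ 2) * Polynomial.X ^ k

/-- The formal power series `p(z²)`. -/
def evalSq (p : Polynomial ℚ) : PowerSeries ℚ :=
  Polynomial.aeval ((PowerSeries.X : PowerSeries ℚ) ^ 2) p

end BinaryForms

end

/-! `SL₂` is generated by its upper and lower unipotent one-parameter subgroups, so a polynomial is
invariant exactly when the raising operator `E` and the lowering operator `Y` of `sl₂`, acting as
derivations, both kill it (`jointInvariants_eq`, `jointCovariants_eq`). On the span of a finite set
of monomials stable under both operators, `E` maps weight 0 onto weight 2, and its kernel in weight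
0 is the space of invariants. Hence its dimension is the number of monomials of weight 0 minus the
number of weight 2 (`finrank_invariants_inf`).

Write `M p` for `n.multichoose p`. There are `M p * M q` monomials of degree `p` in the first and
`q` in the second coefficients of the forms, and they have weight `p - q`. So invariants vanish in
odd degree and have dimension `M e ^ 2 - M (e + 1) * M (e - 1)` in degree `2 * e > 0`. For
covariants the order is first cut off at `K`. For every `K` at least the degree the count gives `M e
^ 2` in degree `2 * e` and `M e * M (e + 1)` in degree `2 * e + 1`; independence of `K` shows that
the cutoff loses nothing.

For `n` in the ranges of (i) and (ii), these dimensions are products of two binomial coefficients,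
up to a constant and a division by `e + 1`. Euler's transformation of `₂F₁` (`mk_choose_mul_choose`,
`mk_choose_mul_choose_div`) turns their generating functions into Narayana polynomials over powers
of `1 - X`, and `X` is replaced by `z²`. The odd part of the covariant series for `n` forms is `n z`
times the invariant series for `n + 1` forms. -/

namespace BinaryForms

/-! ### Generating functions of products of binomial coefficients. -/

open PowerSeries in
/-- If `G = P * (1 - X) ^ (-N)`, then multiplying the `e`-th coefficient of `G` by `e + c`
corresponds to an explicit transformation of `P`. -/
theorem mul_one_sub_pow_succ_of_coeff {G G' P P' : PowerSeries ℚ} {N : ℕ} {c d : ℚ} (hd : d ≠ 0)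
    (h : G * (1 - X) ^ N = P)
    (hG : ∀ e, d * coeff e G' = (e + c) * coeff e G)
    (hP0 : d * coeff 0 P' = c * coeff 0 P)
    (hP : ∀ k, d * coeff (k + 1) P' = (k + 1 + c) * coeff (k + 1) P + (N - k - c) * coeff k P) :
    G' * (1 - X) ^ (N + 1) = P' := by
  -- With `θ = X d/dX`, the hypothesis on `G'` says `d G' = (θ + c) G`. Conjugation by `(1 - X) ^ N`
  -- turns `θ + c` into `(1 - X)(θ + c) + N X` acting on `P`, at the cost of one more factor `1 -
  -- X`; this is `hP1`.
  have hG1 : C d * G' = X * derivative ℚ G + C c * G := by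
    ext e
    cases e with
    | zero => simpa using hG 0
    | succ e => simp [hG, coeff_succ_X_mul, coeff_derivative]; ring
  have hP1 : C d * P' = (1 - X) * (X * derivative ℚ P + C c * P) + C (N : ℚ) * (X * P) := by
    generalize (N : ℚ) = ν at hP ⊢
    ext k
    cases k with
    | zero => simpa [sub_mul] using hP0
    | succ k =>
      have : coeff k (X * derivative ℚ P) = k * coeff k P := by
        cases k with
        | zero => simp
        | succ k => simp [coeff_succ_X_mul, coeff_derivative]; ring
      simp [hP, coeff_succ_X_mul, sub_mul, this, coeff_derivative]; ring
  have hD : derivative ℚ P * (1 - X) =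
      derivative ℚ G * (1 - X) ^ (N + 1) - C (N : ℚ) * G * (1 - X) ^ N := by
    rw [← h]
    cases N with
    | zero => simp
    | succ N =>
      simp [Derivation.leibniz]
      ring
  have hCd : (C d : PowerSeries ℚ) ≠ 0 := by simpa using hd
  apply mul_left_cancel₀ hCd
  rw [hP1, ← mul_assoc, hG1]
  have : (1 - X) * (X * derivative ℚ P + C c * P) =
      X * (derivative ℚ P * (1 - X)) + (1 - X) * (C c * P) := by ring
  rw [this, hD, ← h]
  ring

open PowerSeries in
theorem mk_choose_mul_one_sub_pow (a : ℕ) :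
    (PowerSeries.mk fun e => ((e + a).choose a : ℚ)) * (1 - X) ^ (a + 1) = 1 := by
  have := (invOneSubPow ℚ (a + 1)).val_inv
  rw [invOneSubPow_val_succ_eq_mk_add_choose, invOneSubPow_inv_eq_one_sub_pow] at this
  simpa [add_comm] using this

theorem succ_mul_choose_cast (m k : ℕ) :
    ((k : ℚ) + 1) * (m.choose (k + 1) : ℚ) = (m - k) * (m.choose k : ℚ) := by
  rcases le_or_gt k m with h | h
  · have := Nat.choose_succ_right_eq m k
    rw [← Nat.cast_sub h]
    exact_mod_cast (by linarith : (k + 1) * m.choose (k + 1) = (m - k) * m.choose k)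
  · rw [Nat.choose_eq_zero_of_lt h, Nat.choose_eq_zero_of_lt (by omega)]; simp

theorem choose_succ_cast (m k : ℕ) :
    ((m + 1).choose (k + 1) : ℚ) = m.choose k + m.choose (k + 1) := by
  rw [Nat.choose_succ_succ]; push_cast; ring

open PowerSeries in
/-- Euler's transformation of `₂F₁(a + 1, b + 1; 1; X)`. -/
theorem mk_choose_mul_choose (a b : ℕ) :
    (PowerSeries.mk fun e => ((e + a).choose a : ℚ) * (e + b).choose b) * (1 - X) ^ (a + b + 1) =
      PowerSeries.mk fun k => (a.choose k : ℚ) * b.choose k := by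
  induction b with
  | zero =>
    convert mk_choose_mul_one_sub_pow a using 2
    · simp
    · ext k; cases k <;> simp [coeff_one]
  | succ b ih =>
    -- The choice `c = d = b + 1` comes from `(b + 1) * (e + b + 1).choose (b + 1) = (e + b + 1) *
    -- (e + b).choose b`. Then `N - k - c = a - k`, the factor that carries `a.choose k` to
    -- `a.choose (k + 1)`.
    refine mul_one_sub_pow_succ_of_coeff (c := b + 1) (d := b + 1) (by positivity) ih ?_ ?_ ?_
    · intro e
      have := succ_mul_choose_cast (e + (b + 1)) b
      have h2 := choose_succ_cast (e + b) b
      have h3 := succ_mul_choose_cast (e + b) b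
      simp only [coeff_mk]
      rw [← add_assoc e b 1, h2]
      push_cast at *
      linear_combination ((e + a).choose a : ℚ) * h3
    · simp
    · intro k
      have h1 := succ_mul_choose_cast a k
      have h2 := choose_succ_cast b k
      have h3 := succ_mul_choose_cast b k
      simp only [coeff_mk]
      rw [h2]
      push_cast
      linear_combination (b.choose k : ℚ) * h1 - (a.choose (k+1) : ℚ) * h3

open PowerSeries in
/-- Euler's transformation of `₂F₁(a + 2, b + 2; 2; X)`. -/
theorem mk_choose_mul_choose_div (a b : ℕ) :
    (PowerSeries.mk fun e => ((e + a + 1).choose (a + 1) : ℚ) * (e + b + 1).choose (b + 1) / (e + 1)) *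
        (1 - X) ^ (a + b + 2) =
      PowerSeries.mk fun k => (a.choose k : ℚ) * b.choose k / (k + 1) := by
  induction b with
  | zero =>
    convert mk_choose_mul_one_sub_pow (a + 1) using 2
    · ext e
      have : (e : ℚ) + 1 ≠ 0 := by positivity
      simp
      field_simp
      simp [add_assoc]
    · ext k; cases k <;> simp [coeff_one]
  | succ b ih =>
    refine mul_one_sub_pow_succ_of_coeff (c := b + 2) (d := b + 2) (by positivity) ih ?_ ?_ ?_
    · intro e
      have h2 := choose_succ_cast (e + b + 1) (b + 1)
      have h3 := succ_mul_choose_cast (e + b + 1) (b + 1)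
      have : (e : ℚ) + 1 ≠ 0 := by positivity
      simp only [coeff_mk]
      rw [← add_assoc e b 1, h2]
      field_simp
      push_cast at *
      linear_combination ((e + a + 1).choose (a + 1) : ℚ) * h3
    · simp
    · intro k
      have h1 := succ_mul_choose_cast a k
      have h2 := choose_succ_cast b k
      have h3 := succ_mul_choose_cast b k
      simp only [coeff_mk]
      rw [h2]
      have : (k : ℚ) + 1 ≠ 0 := by positivity
      have : (k : ℚ) + 1 + 1 ≠ 0 := by positivity
      push_cast
      field_simp
      linear_combination (b.choose k : ℚ) * h1 * (k+2) - (a.choose (k+1) : ℚ) * h3 * (k+1)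

/-! ### Representation theory of `sl₂` with weights bounded above. -/

/-- Weight spaces `V m`, `m ∈ ℤ`, of operators `E` and `Y` that satisfy the `sl₂` relations, with
weights bounded above. -/
structure IsWeightGrading {M : Type*} [AddCommGroup M] [Module ℂ M] (V : ℤ → Submodule ℂ M)
    (E Y : M →ₗ[ℂ] M) : Prop where
  raise : ∀ m, ∀ v ∈ V m, E v ∈ V (m + 2)
  lower : ∀ m, ∀ v ∈ V m, Y v ∈ V (m - 2)
  comm : ∀ m, ∀ v ∈ V m, E (Y v) - Y (E v) = (m : ℂ) • v
  bounded : ∃ N : ℤ, ∀ m, N ≤ m → V m = ⊥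

namespace IsWeightGrading

variable {M : Type*} [AddCommGroup M] [Module ℂ M] {V : ℤ → Submodule ℂ M} {E Y : M →ₗ[ℂ] M}

/-- Since `EY = YE + m` in weight `m`, the equation reads `(YE + (m + c)) v = 0`. Applying `E` gives
the same kind of equation for `E v` in weight `m + 2` with constant `m + c`, so the free constant
`c` lets the induction close; `k` bounds the number of steps left to the vanishing weights. Once `E
v = 0`, what remains is `(m + c) • v = 0` with `m + c > 0`. -/
theorem eq_zero_of_raise_lower_add_smul (h : IsWeightGrading V E Y) {N : ℤ}
    (hN : ∀ m, N ≤ m → V m = ⊥) (k : ℕ) :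
    ∀ (m : ℤ) (c : ℕ), 0 < m → N ≤ m + 2 * k → ∀ v ∈ V m, E (Y v) + (c : ℂ) • v = 0 → v = 0 := by
  induction k with
  | zero =>
    intro m c _ hm v hv _
    have := hN m (by simpa using hm)
    rw [this] at hv
    simpa using hv
  | succ k ih =>
    intro m c hm hmk v hv hz
    have hc := h.comm m v hv
    obtain ⟨l, rfl⟩ : ∃ l : ℕ, m = l := ⟨m.toNat, by omega⟩
    have hl : 0 < l := by exact_mod_cast hm
    have hYE : Y (E v) + ((l + c : ℕ) : ℂ) • v = 0 := by
      have : E (Y v) = Y (E v) + (l : ℂ) • v := by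
        rw [← sub_eq_iff_eq_add']; simpa using hc
      rw [this] at hz
      push_cast
      rw [add_smul, ← add_assoc]; exact hz
    have hE : E v = 0 := by
      refine ih (l + 2) (l + c) (by omega) (by push_cast at hmk ⊢; linarith) _ (h.raise _ _ hv) ?_
      have := congrArg E hYE
      simpa using this
    rw [hE, map_zero, zero_add, smul_eq_zero] at hYE
    rcases hYE with h0 | h0
    · exfalso
      have : l + c = 0 := by exact_mod_cast h0
      omega
    · exact h0

theorem eq_zero_of_raise_lower (h : IsWeightGrading V E Y) {m : ℤ} (hm : 0 < m) {v : M}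
    (hv : v ∈ V m) (hz : E (Y v) = 0) : v = 0 := by
  obtain ⟨N, hN⟩ := h.bounded
  exact h.eq_zero_of_raise_lower_add_smul hN (N - m).toNat m 0 hm (by omega) v hv (by simpa using hz)

/-- `EY` is injective on the finite-dimensional space `V 2`, hence surjective, and `Y` lands in `V
0`. -/
theorem exists_raise_eq (h : IsWeightGrading V E Y) [FiniteDimensional ℂ (V 2)] {w : M}
    (hw : w ∈ V 2) : ∃ v ∈ V 0, E v = w := by
  let T : V 2 →ₗ[ℂ] V 2 := (E ∘ₗ Y).restrict (p := V 2) (q := V 2) fun v hv => by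
    simpa using h.raise _ _ (h.lower _ _ hv)
  have hT : Function.Injective T := by
    rw [← LinearMap.ker_eq_bot, LinearMap.ker_eq_bot']
    intro v hv
    have : E (Y v) = 0 := by simpa [T] using congrArg Subtype.val hv
    exact Subtype.ext (h.eq_zero_of_raise_lower (by norm_num) v.2 this)
  obtain ⟨v, hv⟩ := LinearMap.injective_iff_surjective.1 hT ⟨w, hw⟩
  refine ⟨Y v, by simpa using h.lower _ _ v.2, ?_⟩
  simpa [T] using congrArg Subtype.val hv

theorem finrank_inf_ker (h : IsWeightGrading V E Y) [FiniteDimensional ℂ (V 0)]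
    [FiniteDimensional ℂ (V 2)] :
    Module.finrank ℂ (V 0 ⊓ LinearMap.ker E : Submodule ℂ M) + Module.finrank ℂ (V 2) =
      Module.finrank ℂ (V 0) := by
  let T : V 0 →ₗ[ℂ] V 2 := E.restrict fun v hv => by simpa using h.raise _ _ hv
  have hT : LinearMap.range T = ⊤ := by
    rw [LinearMap.range_eq_top]
    rintro ⟨w, hw⟩
    obtain ⟨v, hv, rfl⟩ := h.exists_raise_eq hw
    exact ⟨⟨v, hv⟩, rfl⟩
  have hr := LinearMap.finrank_range_add_finrank_ker T
  rw [hT, finrank_top] at hr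
  have hk : LinearMap.ker T = (LinearMap.ker E).comap (V 0).subtype := by
    ext v; simp [T, Subtype.ext_iff]
  have : Module.finrank ℂ (LinearMap.ker T) =
      Module.finrank ℂ (V 0 ⊓ LinearMap.ker E : Submodule ℂ M) := by
    rw [hk, ← Submodule.map_comap_subtype]
    exact (Submodule.equivMapOfInjective _ (V 0).injective_subtype _).finrank_eq
  omega

/-- In weight 0, `E (Y v) = Y (E v) = 0`. In the grading with `E` and `Y` exchanged, `Y v` has
weight 2, where `YE` is injective. -/
theorem lower_eq_zero (h : IsWeightGrading V E Y) (h' : IsWeightGrading (fun m => V (-m)) Y E)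
    {v : M} (hv : v ∈ V 0) (hE : E v = 0) : Y v = 0 := by
  have hY : Y v ∈ V (-2) := by simpa using h.lower _ _ hv
  refine h'.eq_zero_of_raise_lower (m := 2) (by norm_num) hY ?_
  have := h.comm 0 v hv
  rw [hE] at this
  have hEY : E (Y v) = 0 := by simpa using this
  rw [hEY, map_zero]

end IsWeightGrading

/-! ### The action of `sl₂` on polynomial rings by derivations. -/

section

open MvPolynomial

/-- A family of variables paired off into the weight bases of two-dimensional `sl₂`-modules: the
raising operator sends a variable `t` of weight `-1` to `sign t` times its partner. -/
structure WeightPairing (τ : Type*) where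
  wt : τ → ℤ
  partner : τ → τ
  sign : τ → ℂ
  wt_eq : ∀ t, wt t = 1 ∨ wt t = -1
  partner_partner : ∀ t, partner (partner t) = t
  wt_partner : ∀ t, wt (partner t) = -wt t
  sign_mul : ∀ t, sign t * sign (partner t) = 1

namespace WeightPairing

variable {τ : Type*} (P : WeightPairing τ)

/-- The pairing with the roles of the two weights exchanged. -/
def neg : WeightPairing τ where
  wt t := -P.wt t
  partner := P.partner
  sign := P.sign
  wt_eq t := by rcases P.wt_eq t with h | h <;> simp [h]
  partner_partner := P.partner_partner
  wt_partner t := by simp [P.wt_partner t]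
  sign_mul := P.sign_mul

theorem neg_neg : P.neg.neg = P := by
  cases P; simp [neg]

/-- The image of a variable under the raising operator. -/
noncomputable def raiseX (t : τ) : MvPolynomial τ ℂ :=
  if P.wt t = -1 then C (P.sign t) * X (P.partner t) else 0

/-- The raising operator on polynomials. -/
noncomputable def raise : Derivation ℂ (MvPolynomial τ ℂ) (MvPolynomial τ ℂ) :=
  mkDerivation ℂ P.raiseX

/-- The lowering operator on polynomials. -/
noncomputable abbrev lower : Derivation ℂ (MvPolynomial τ ℂ) (MvPolynomial τ ℂ) := P.neg.raise

theorem raise_X (t : τ) : P.raise (X t) = P.raiseX t := mkDerivation_X _ _ _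

theorem raise_C_mul_X (c : ℂ) (t : τ) : P.raise (C c * X t) = C c * P.raiseX t := by
  rw [C_mul', Derivation.map_smul, raise_X, C_mul']

theorem raise_raiseX (t : τ) : P.raise (P.raiseX t) = 0 := by
  unfold raiseX
  split_ifs with h
  · rw [raise_C_mul_X, raiseX, if_neg, mul_zero]
    rw [P.wt_partner, h]; norm_num
  · simp

/-- The weight operator on polynomials. -/
noncomputable def cartan : Derivation ℂ (MvPolynomial τ ℂ) (MvPolynomial τ ℂ) :=
  mkDerivation ℂ fun t => C (P.wt t : ℂ) * X t

/-- A commutator of derivations is a derivation, so it suffices to compare values on the variables.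
-/
theorem commutator_raise_lower : ⁅P.raise, P.lower⁆ = P.cartan := by
  apply derivation_ext
  intro t
  rw [Derivation.commutator_apply, cartan, mkDerivation_X, raise_X, raise_X]
  have hw : P.neg.wt t = - P.wt t := rfl
  rcases P.wt_eq t with h | h
  · have h1 : P.raiseX t = 0 := by rw [raiseX, if_neg]; rw [h]; norm_num
    have h2 : P.neg.raiseX t = C (P.sign t) * X (P.partner t) := by
      rw [raiseX, if_pos]; rfl
      rw [hw, h]
    rw [h1, h2, map_zero, sub_zero, raise_C_mul_X, raiseX, if_pos (by rw [P.wt_partner, h]),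
      ← mul_assoc, ← C_mul, P.sign_mul, P.partner_partner, h]
    simp
  · have h1 : P.neg.raiseX t = 0 := by rw [raiseX, if_neg]; rw [hw, h]; norm_num
    have h2 : P.raiseX t = C (P.sign t) * X (P.partner t) := by
      rw [raiseX, if_pos h]
    have hp : P.neg.wt (P.partner t) = -1 := by
      show - P.wt (P.partner t) = -1
      rw [P.wt_partner, h]; norm_num
    have hs : P.neg.sign (P.partner t) = P.sign (P.partner t) := rfl
    have hpp : P.neg.partner (P.partner t) = t := P.partner_partner t
    rw [h1, h2, map_zero, zero_sub, lower, raise_C_mul_X, raiseX, if_pos hp, hs, hpp,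
      ← mul_assoc, ← C_mul, P.sign_mul, h]
    simp

theorem cartan_monomial (d : τ →₀ ℕ) (r : ℂ) :
    P.cartan (monomial d r) = (Finsupp.weight P.wt d : ℂ) • monomial d r := by
  rw [cartan, mkDerivation_monomial, Finsupp.weight_apply, Finsupp.sum, Finsupp.sum]
  push_cast
  rw [Finset.sum_smul, Finset.smul_sum]
  refine Finset.sum_congr rfl fun t ht => ?_
  have h1 : d t ≠ 0 := by simpa using ht
  have h2 : d - Finsupp.single t 1 + Finsupp.single t 1 = d := by
    apply tsub_add_cancel_of_le
    simpa using Nat.one_le_iff_ne_zero.2 h1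
  rw [smul_eq_mul, X, C_mul_monomial, monomial_mul, h2, smul_monomial, smul_monomial]
  congr 1
  simp only [smul_eq_mul, nsmul_eq_mul]
  push_cast
  ring

theorem coeff_cartan (F : MvPolynomial τ ℂ) (d : τ →₀ ℕ) :
    coeff d (P.cartan F) = (Finsupp.weight P.wt d : ℂ) * coeff d F := by
  classical
  induction F using MvPolynomial.induction_on' with
  | monomial u a =>
    rw [cartan_monomial]
    simp only [coeff_smul, coeff_monomial, smul_eq_mul]
    split_ifs with h
    · subst h; ring
    · simp
  | add p q hp hq => rw [map_add, coeff_add, coeff_add, hp, hq, mul_add]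

/-- The span of the monomials of weight `m` with exponents in `S`. -/
noncomputable abbrev weightSpace (S : Set (τ →₀ ℕ)) (m : ℤ) : Submodule ℂ (MvPolynomial τ ℂ) :=
  restrictSupport ℂ {d | d ∈ S ∧ Finsupp.weight P.wt d = m}

/-- A set of exponents is stable if it is closed under replacing a variable by its partner. -/
def IsStable (S : Set (τ →₀ ℕ)) : Prop :=
  ∀ d ∈ S, ∀ t, d t ≠ 0 → d - Finsupp.single t 1 + Finsupp.single (P.partner t) 1 ∈ S

theorem weight_replace {d : τ →₀ ℕ} {t : τ} (ht : d t ≠ 0) :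
    Finsupp.weight P.wt (d - Finsupp.single t 1 + Finsupp.single (P.partner t) 1) =
      Finsupp.weight P.wt d - 2 * P.wt t := by
  have := Finsupp.weight_sub_single_add (w := P.wt) ht
  rw [map_add, Finsupp.weight_single, ← this, P.wt_partner]
  simp
  ring

theorem raise_mem {S : Set (τ →₀ ℕ)} (hS : P.IsStable S) {m : ℤ} {F : MvPolynomial τ ℂ}
    (hF : F ∈ P.weightSpace S m) : P.raise F ∈ P.weightSpace S (m + 2) := by
  rw [weightSpace, restrictSupport_eq_span] at hF
  induction hF using Submodule.span_induction with
  | zero => simp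
  | add x y _ _ hx hy => rw [map_add]; exact add_mem hx hy
  | smul a x _ hx => rw [Derivation.map_smul]; exact Submodule.smul_mem _ _ hx
  | mem x hx =>
    obtain ⟨d, ⟨hd, hw⟩, rfl⟩ := hx
    dsimp only
    rw [raise, mkDerivation_monomial, one_smul]
    refine Submodule.sum_mem _ fun t ht => ?_
    have ht : d t ≠ 0 := by simpa using ht
    dsimp only
    rw [smul_eq_mul, raiseX]
    split_ifs with h
    · rw [X, C_mul_monomial, monomial_mul, monomial_mem_restrictSupport]
      left
      refine ⟨hS d hd t ht, ?_⟩
      rw [P.weight_replace ht, hw, h]; ring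
    · simp

theorem neg_weight (d : τ →₀ ℕ) : Finsupp.weight P.neg.wt d = - Finsupp.weight P.wt d := by
  simp [Finsupp.weight_apply, Finsupp.sum, neg]

theorem neg_weightSpace (S : Set (τ →₀ ℕ)) (m : ℤ) :
    P.neg.weightSpace S m = P.weightSpace S (-m) := by
  simp only [weightSpace, neg_weight, neg_eq_iff_eq_neg]

theorem lower_mem {S : Set (τ →₀ ℕ)} (hS : P.IsStable S) {m : ℤ} {F : MvPolynomial τ ℂ}
    (hF : F ∈ P.weightSpace S m) : P.lower F ∈ P.weightSpace S (m - 2) := by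
  have h1 : F ∈ P.neg.weightSpace S (-m) := by rwa [neg_weightSpace, _root_.neg_neg]
  have h2 := P.neg.raise_mem (S := S) hS h1
  rw [neg_weightSpace] at h2
  convert h2 using 2
  ring

/-- The commutation relation holds because the Cartan operator multiplies each monomial by its
weight; the weights are bounded because `S` is finite. -/
theorem isWeightGrading {S : Set (τ →₀ ℕ)} (hS : P.IsStable S) (hfin : S.Finite) :
    IsWeightGrading (P.weightSpace S) P.raise.toLinearMap P.lower.toLinearMap where
  raise m v hv := P.raise_mem hS hv
  lower m v hv := P.lower_mem hS hv
  comm m v hv := by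
    have := congrArg (fun D => D v) P.commutator_raise_lower
    simp only [Derivation.commutator_apply] at this
    refine Eq.trans this ?_
    ext d
    rw [coeff_cartan, coeff_smul, smul_eq_mul]
    by_cases hd : coeff d v = 0
    · simp [hd]
    · rw [(hv (mem_support_iff.2 hd)).2]
  bounded := by
    obtain ⟨N, hN⟩ := (hfin.image (Finsupp.weight P.wt)).bddAbove
    refine ⟨N + 1, fun m hm => ?_⟩
    have : {d | d ∈ S ∧ Finsupp.weight P.wt d = m} = ∅ := by
      ext d
      simp only [Set.mem_ofPred_eq, Set.mem_empty_iff_false, iff_false, not_and]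
      intro hd h
      have := hN ⟨d, hd, rfl⟩
      omega
    rw [weightSpace, this, restrictSupport_eq_span]
    simp

theorem finrank_restrictSupport (S : Set (τ →₀ ℕ)) :
    Module.finrank ℂ (restrictSupport ℂ S) = S.ncard := by
  rw [Module.finrank_eq_nat_card_basis (basisRestrictSupport ℂ S), Nat.card_coe_set_eq]

theorem finiteDimensional_restrictSupport {S : Set (τ →₀ ℕ)} (hS : S.Finite) :
    FiniteDimensional ℂ (restrictSupport ℂ S) :=
  have := hS.to_subtype
  Module.Finite.of_basis (basisRestrictSupport ℂ S)

/-- The polynomials annihilated by the raising and the lowering operator. -/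
noncomputable def invariants : Submodule ℂ (MvPolynomial τ ℂ) :=
  LinearMap.ker P.raise.toLinearMap ⊓ LinearMap.ker P.lower.toLinearMap

theorem mem_invariants {F : MvPolynomial τ ℂ} :
    F ∈ P.invariants ↔ P.raise F = 0 ∧ P.lower F = 0 := by
  simp [invariants]

/-- A polynomial killed by both operators is killed by their commutator, so all its monomials have
weight 0. Conversely, in weight 0 being killed by `E` forces being killed by `Y`. -/
theorem invariants_inf_restrictSupport {S : Set (τ →₀ ℕ)} (hS : P.IsStable S) (hfin : S.Finite) :
    P.invariants ⊓ restrictSupport ℂ S =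
      P.weightSpace S 0 ⊓ LinearMap.ker P.raise.toLinearMap := by
  have h := P.isWeightGrading hS hfin
  have h' := P.neg.isWeightGrading (S := S) hS hfin
  rw [funext (P.neg_weightSpace S), lower, P.neg_neg] at h'
  ext F
  simp only [Submodule.mem_inf, mem_invariants, LinearMap.mem_ker]
  constructor
  · rintro ⟨⟨hE, hY⟩, hF⟩
    refine ⟨fun d hd => ⟨hF hd, ?_⟩, hE⟩
    have hH : P.cartan F = 0 := by
      rw [← commutator_raise_lower, Derivation.commutator_apply, hE, hY, map_zero, map_zero,
        sub_zero]
    have := P.coeff_cartan F d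
    rw [hH, coeff_zero, eq_comm, mul_eq_zero] at this
    rcases this with h | h
    · exact_mod_cast h
    · exact absurd h (mem_support_iff.1 hd)
  · rintro ⟨hF, hE⟩
    exact ⟨⟨hE, h.lower_eq_zero h' hF hE⟩, fun d hd => (hF hd).1⟩

/-- The dimension of a space of invariants is the difference of the dimensions of the spaces of
weight `0` and of weight `2`. -/
theorem finrank_invariants_inf {S : Set (τ →₀ ℕ)} (hS : P.IsStable S) (hfin : S.Finite) :
    Module.finrank ℂ (P.invariants ⊓ restrictSupport ℂ S : Submodule ℂ (MvPolynomial τ ℂ)) +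
        {d | d ∈ S ∧ Finsupp.weight P.wt d = 2}.ncard =
      {d | d ∈ S ∧ Finsupp.weight P.wt d = 0}.ncard := by
  have : ∀ m, FiniteDimensional ℂ (P.weightSpace S m) := fun m =>
    finiteDimensional_restrictSupport (hfin.subset fun d hd => hd.1)
  rw [invariants_inf_restrictSupport P hS hfin, ← finrank_restrictSupport,
    ← finrank_restrictSupport, ← (P.isWeightGrading hS hfin).finrank_inf_ker]

theorem finiteDimensional_invariants_inf {S : Set (τ →₀ ℕ)} (hfin : S.Finite) :
    FiniteDimensional ℂ
      (P.invariants ⊓ restrictSupport ℂ S : Submodule ℂ (MvPolynomial τ ℂ)) :=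
  have := finiteDimensional_restrictSupport hfin
  Submodule.finiteDimensional_inf_right _ _

/-- The one-parameter group generated by the raising operator. -/
noncomputable def flow (s : ℂ) : MvPolynomial τ ℂ →ₐ[ℂ] MvPolynomial τ ℂ :=
  aeval fun t => X t + C s * P.raiseX t

/-- The one-parameter group generated by the raising operator, with the parameter as a variable. -/
noncomputable def genericFlow : MvPolynomial τ ℂ →ₐ[ℂ] Polynomial (MvPolynomial τ ℂ) :=
  aeval fun t => Polynomial.C (X t) + Polynomial.X * Polynomial.C (P.raiseX t)

theorem genericFlow_C (a : ℂ) : P.genericFlow (C a) = Polynomial.C (C a) := by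
  rw [genericFlow, aeval_C]; rfl

theorem genericFlow_X (t : τ) :
    P.genericFlow (X t) = Polynomial.C (X t) + Polynomial.X * Polynomial.C (P.raiseX t) := by
  rw [genericFlow, aeval_X]

theorem eval_genericFlow (s : ℂ) (F : MvPolynomial τ ℂ) :
    (P.genericFlow F).eval (C s) = P.flow s F := by
  induction F using MvPolynomial.induction_on with
  | C a => rw [genericFlow_C, flow, aeval_C]; simp [algebraMap_eq]
  | add p q hp hq => rw [map_add, map_add, Polynomial.eval_add, hp, hq]
  | mul_X p t hp =>
    rw [map_mul, map_mul, Polynomial.eval_mul, hp, genericFlow_X, flow, aeval_X]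
    simp [mul_comm (C s)]

theorem flow_zero (F : MvPolynomial τ ℂ) : P.flow 0 F = F := by
  simp [flow]

/-- The derivative of `exp (sE)` in `s` is `exp (sE) E`. On variables the exponential is affine in
`s`, because `E` squares to zero there. -/
theorem derivative_genericFlow (F : MvPolynomial τ ℂ) :
    (P.genericFlow F).derivative = P.genericFlow (P.raise F) := by
  induction F using MvPolynomial.induction_on with
  | C a => rw [genericFlow_C]; simp
  | add p q hp hq => simp [hp, hq]
  | mul_X p t hp =>
    have hR : P.genericFlow (P.raiseX t) = Polynomial.C (P.raiseX t) := by
      have hrr := P.raise_raiseX t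
      unfold raiseX at hrr ⊢
      split_ifs with h
      · rw [if_pos h, raise_C_mul_X, raiseX] at hrr
        rw [map_mul, genericFlow_C, genericFlow_X, raiseX, if_neg, Polynomial.C_mul]
        · simp
        · rw [P.wt_partner, h]; norm_num
      · simp
    rw [map_mul, Polynomial.derivative_mul, hp, Derivation.leibniz, raise_X, map_add, smul_eq_mul,
      smul_eq_mul, map_mul, map_mul, hR, genericFlow_X]
    simp
    ring

/-- The flow of `F` is a polynomial in `s` whose derivative is the flow of `E F`. In characteristic
zero it is constant when `E F = 0`; conversely, if it equals `F` at infinitely many `s` it is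
constant, and its derivative at `s = 0` is `E F`. -/
theorem raise_eq_zero_iff (F : MvPolynomial τ ℂ) :
    P.raise F = 0 ↔ ∀ s, P.flow s F = F := by
  constructor
  · intro h s
    have hd := P.derivative_genericFlow F
    rw [h, map_zero] at hd
    have hc := Polynomial.eq_C_of_derivative_eq_zero hd
    have h0 := P.eval_genericFlow 0 F
    rw [flow_zero, hc, Polynomial.eval_C] at h0
    rw [← eval_genericFlow, hc, Polynomial.eval_C, h0]
  · intro h
    have hc : P.genericFlow F = Polynomial.C F := by
      apply Polynomial.eq_of_infinite_eval_eq
      refine Set.Infinite.mono (s := Set.range (C : ℂ → MvPolynomial τ ℂ)) ?_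
        (Set.infinite_range_of_injective (C_injective _ _))
      rintro _ ⟨s, rfl⟩
      simp [eval_genericFlow, h]
    have hd := P.derivative_genericFlow F
    rw [hc, Polynomial.derivative_C] at hd
    have := congrArg (Polynomial.eval (C 0)) hd
    rw [eval_genericFlow, flow_zero] at this
    simpa using this.symm

end WeightPairing

end

/-! ### From the Lie algebra to the group `SL₂`. -/

section

open MvPolynomial

theorem WeightPairing.eval_flow {τ : Type*} (P : WeightPairing τ) (s : ℂ) (x : τ → ℂ)
    (F : MvPolynomial τ ℂ) :
    eval x (P.flow s F) = eval (fun t => x t + s * eval x (P.raiseX t)) F := by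
  induction F using MvPolynomial.induction_on with
  | C a => rw [flow, aeval_C]; simp [algebraMap_eq]
  | add p q hp hq => simp only [map_add, hp, hq]
  | mul_X p t hp =>
    simp only [map_mul, hp, eval_X]
    congr 1
    rw [flow, aeval_X]
    simp

/-- The matrix `!![1, s; 0, 1]`. -/
def upperUnipotent (s : ℂ) : SL(2, ℂ) := ⟨!![1, s; 0, 1], by simp⟩

/-- The matrix `!![1, 0; s, 1]`. -/
def lowerUnipotent (s : ℂ) : SL(2, ℂ) := ⟨!![1, 0; s, 1], by simp⟩

theorem coe_upperUnipotent (s : ℂ) :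
    (upperUnipotent s : Matrix (Fin 2) (Fin 2) ℂ) = !![1, s; 0, 1] := rfl

theorem coe_lowerUnipotent (s : ℂ) :
    (lowerUnipotent s : Matrix (Fin 2) (Fin 2) ℂ) = !![1, 0; s, 1] := rfl

theorem LinearForm.act_upperUnipotent (s : ℂ) (a : LinearForm) :
    a.act (upperUnipotent s) = ![a 0, a 1 - s * a 0] := by
  rw [LinearForm.act, Matrix.SpecialLinearGroup.coe_inv, coe_upperUnipotent,
    Matrix.adjugate_fin_two]
  ext j
  fin_cases j <;> simp [Matrix.vecMul, dotProduct, Fin.sum_univ_two]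
  ring

theorem LinearForm.act_lowerUnipotent (s : ℂ) (a : LinearForm) :
    a.act (lowerUnipotent s) = ![a 0 - s * a 1, a 1] := by
  rw [LinearForm.act, Matrix.SpecialLinearGroup.coe_inv, coe_lowerUnipotent,
    Matrix.adjugate_fin_two]
  ext j
  fin_cases j <;> simp [Matrix.vecMul, dotProduct, Fin.sum_univ_two]
  ring

/-- `SL₂` is generated by the unipotent upper and lower triangular matrices. -/
theorem SL2_induction {Q : SL(2, ℂ) → Prop} (hmul : ∀ g h, Q g → Q h → Q (g * h))
    (hu : ∀ s, Q (upperUnipotent s)) (hl : ∀ s, Q (lowerUnipotent s)) (g : SL(2, ℂ)) : Q g := by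
  have key : ∀ g : SL(2, ℂ), g.1 1 0 ≠ 0 → Q g := by
    intro g hg
    have hdet := g.2
    rw [Matrix.det_fin_two] at hdet
    -- With rows `(a, b)` and `(c, d)` and `c ≠ 0`, the middle factor supplies `c`, the outer two
    -- correct `a` and `d`, and the determinant forces `b`.
    have : g = upperUnipotent ((g.1 0 0 - 1) / g.1 1 0) * lowerUnipotent (g.1 1 0) *
        upperUnipotent ((g.1 1 1 - 1) / g.1 1 0) := by
      apply Subtype.ext
      rw [Matrix.SpecialLinearGroup.coe_mul, Matrix.SpecialLinearGroup.coe_mul,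
        coe_upperUnipotent, coe_lowerUnipotent, coe_upperUnipotent]
      ext i j
      fin_cases i <;> fin_cases j <;>
        simp [Matrix.mul_apply, Fin.sum_univ_two]
      all_goals
        field_simp
        first | ring1 | linear_combination -hdet
    rw [this]
    exact hmul _ _ (hmul _ _ (hu _) (hl _)) (hu _)
  by_cases hg : g.1 1 0 = 0
  · have h00 : g.1 0 0 ≠ 0 := by
      intro h
      have hdet := g.2
      rw [Matrix.det_fin_two, h, hg] at hdet
      simp at hdet
    -- Adding the first row to the second makes the lower left entry equal to `a ≠ 0`, which reduces
    -- to the previous case.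
    have : g = lowerUnipotent (-1) * (lowerUnipotent 1 * g) := by
      apply Subtype.ext
      rw [Matrix.SpecialLinearGroup.coe_mul, Matrix.SpecialLinearGroup.coe_mul,
        coe_lowerUnipotent, coe_lowerUnipotent]
      ext i j
      fin_cases i <;> fin_cases j <;> simp [Matrix.vecMul, dotProduct, Fin.sum_univ_two]
    rw [this]
    refine hmul _ _ (hl _) (key _ ?_)
    rw [Matrix.SpecialLinearGroup.coe_mul, coe_lowerUnipotent]
    simpa [Matrix.mul_apply, Fin.sum_univ_two, hg] using h00
  · exact key g hg

theorem LinearForm.act_mul (g h : SL(2, ℂ)) (a : LinearForm) :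
    a.act (g * h) = (a.act h).act g := by
  simp [LinearForm.act, mul_inv_rev]

/-- The weights of the coefficients of `n` binary linear forms. -/
def formsPairing (n : ℕ) : WeightPairing (Fin n × Fin 2) where
  wt p := if p.2 = 0 then 1 else -1
  partner p := (p.1, 1 - p.2)
  sign _ := 1
  wt_eq p := by by_cases h : p.2 = 0 <;> simp [h]
  partner_partner p := by simp
  wt_partner := by
    rintro ⟨i, s⟩; fin_cases s <;> simp
  sign_mul := by simp

/-- The weights of the coefficients of `n` binary linear forms and of the coordinates of a
vector. -/
def formsVecPairing (n : ℕ) : WeightPairing ((Fin n × Fin 2) ⊕ Fin 2) where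
  wt := Sum.elim (formsPairing n).wt fun s => if s = 0 then -1 else 1
  partner := Sum.map (formsPairing n).partner fun s => 1 - s
  -- Vectors transform by `g` and coefficients of forms by `g⁻¹`, so the coordinates have opposite
  -- weights and the opposite sign.
  sign := Sum.elim (fun _ => 1) fun _ => -1
  wt_eq := by
    rintro (p | s)
    · exact (formsPairing n).wt_eq p
    · by_cases h : s = 0 <;> simp [h]
  partner_partner := by
    rintro (p | s)
    · simp [(formsPairing n).partner_partner p]
    · simp
  wt_partner := by
    rintro (p | s)
    · simpa using (formsPairing n).wt_partner p
    · fin_cases s <;> simp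
  sign_mul := by rintro (p | s) <;> simp

/-- The parameter is `-s` because the action on forms substitutes `g⁻¹`. -/
theorem eval_formsPairing_flow {n : ℕ} (s : ℂ) (f : Fin n → LinearForm)
    (F : MvPolynomial (Fin n × Fin 2) ℂ) :
    evalForms f ((formsPairing n).flow s F) =
      evalForms (fun i => (f i).act (upperUnipotent (-s))) F := by
  rw [evalForms, WeightPairing.eval_flow, evalForms]
  congr 2
  ext ⟨i, j⟩
  fin_cases j <;>
    simp [WeightPairing.raiseX, formsPairing, LinearForm.act_upperUnipotent]

theorem eval_formsPairing_neg_flow {n : ℕ} (s : ℂ) (f : Fin n → LinearForm)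
    (F : MvPolynomial (Fin n × Fin 2) ℂ) :
    evalForms f ((formsPairing n).neg.flow s F) =
      evalForms (fun i => (f i).act (lowerUnipotent (-s))) F := by
  rw [evalForms, WeightPairing.eval_flow, evalForms]
  congr 2
  ext ⟨i, j⟩
  fin_cases j <;>
    simp [WeightPairing.raiseX, WeightPairing.neg, formsPairing, LinearForm.act_lowerUnipotent]

theorem eval_formsVecPairing_flow {n : ℕ} (s : ℂ) (f : Fin n → LinearForm) (v : Fin 2 → ℂ)
    (F : MvPolynomial ((Fin n × Fin 2) ⊕ Fin 2) ℂ) :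
    evalFormsVec f v ((formsVecPairing n).flow s F) =
      evalFormsVec (fun i => (f i).act (upperUnipotent (-s)))
        ((upperUnipotent (-s) : Matrix (Fin 2) (Fin 2) ℂ) *ᵥ v) F := by
  rw [evalFormsVec, WeightPairing.eval_flow, evalFormsVec]
  congr 2
  ext (⟨i, j⟩ | j) <;> fin_cases j <;>
    simp [WeightPairing.raiseX, formsVecPairing, formsPairing, LinearForm.act_upperUnipotent,
      coe_upperUnipotent, Matrix.vecHead, Matrix.vecTail]

theorem eval_formsVecPairing_neg_flow {n : ℕ} (s : ℂ) (f : Fin n → LinearForm) (v : Fin 2 → ℂ)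
    (F : MvPolynomial ((Fin n × Fin 2) ⊕ Fin 2) ℂ) :
    evalFormsVec f v ((formsVecPairing n).neg.flow s F) =
      evalFormsVec (fun i => (f i).act (lowerUnipotent (-s)))
        ((lowerUnipotent (-s) : Matrix (Fin 2) (Fin 2) ℂ) *ᵥ v) F := by
  rw [evalFormsVec, WeightPairing.eval_flow, evalFormsVec]
  congr 2
  ext (⟨i, j⟩ | j) <;> fin_cases j <;>
    simp [WeightPairing.raiseX, WeightPairing.neg, formsVecPairing, formsPairing,
      LinearForm.act_lowerUnipotent, coe_lowerUnipotent, Matrix.vecHead, Matrix.vecTail]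
  ring

theorem evalForms_injective {n : ℕ} {F G : MvPolynomial (Fin n × Fin 2) ℂ}
    (h : ∀ f, evalForms f F = evalForms f G) : F = G :=
  MvPolynomial.funext fun x => h fun i j => x (i, j)

theorem evalFormsVec_injective {n : ℕ} {F G : MvPolynomial ((Fin n × Fin 2) ⊕ Fin 2) ℂ}
    (h : ∀ f v, evalFormsVec f v F = evalFormsVec f v G) : F = G := by
  refine MvPolynomial.funext fun x => ?_
  have := h (fun i j => x (.inl (i, j))) (fun j => x (.inr j))
  rw [evalFormsVec, evalFormsVec] at this
  convert this using 3 <;> ext (_ | _) <;> rfl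

/-- Invariance under `SL₂` is invariance under its Lie algebra. -/
theorem jointInvariants_eq (n : ℕ) :
    Subalgebra.toSubmodule (jointInvariants n) = (formsPairing n).invariants := by
  ext F
  rw [WeightPairing.mem_invariants, WeightPairing.raise_eq_zero_iff,
    WeightPairing.raise_eq_zero_iff, Subalgebra.mem_toSubmodule]
  constructor
  · intro hF
    refine ⟨fun s => evalForms_injective fun f => ?_, fun s => evalForms_injective fun f => ?_⟩
    · rw [eval_formsPairing_flow]; exact hF _ f
    · rw [eval_formsPairing_neg_flow]; exact hF _ f
  · rintro ⟨hE, hY⟩ g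
    induction g using SL2_induction with
    | hmul g h hg hh =>
      intro f
      simp only [LinearForm.act_mul]
      rw [hg, hh]
    | hu s => intro f; rw [← neg_neg s, ← eval_formsPairing_flow, hE]
    | hl s => intro f; rw [← neg_neg s, ← eval_formsPairing_neg_flow, hY]

/-- Covariance under `SL₂` is invariance under its Lie algebra. -/
theorem jointCovariants_eq (n : ℕ) :
    Subalgebra.toSubmodule (jointCovariants n) = (formsVecPairing n).invariants := by
  ext F
  rw [WeightPairing.mem_invariants, WeightPairing.raise_eq_zero_iff,
    WeightPairing.raise_eq_zero_iff, Subalgebra.mem_toSubmodule]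
  constructor
  · intro hF
    refine ⟨fun s => evalFormsVec_injective fun f v => ?_,
      fun s => evalFormsVec_injective fun f v => ?_⟩
    · rw [eval_formsVecPairing_flow]; exact hF _ f v
    · rw [eval_formsVecPairing_neg_flow]; exact hF _ f v
  · rintro ⟨hE, hY⟩ g
    induction g using SL2_induction with
    | hmul g h hg hh =>
      intro f v
      simp only [LinearForm.act_mul, Matrix.SpecialLinearGroup.coe_mul, ← Matrix.mulVec_mulVec]
      rw [hg, hh]
    | hu s => intro f v; rw [← neg_neg s, ← eval_formsVecPairing_flow, hE]
    | hl s => intro f v; rw [← neg_neg s, ← eval_formsVecPairing_neg_flow, hY]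

end

/-! ### Counting monomials by degree and weight. -/

section

open MvPolynomial

/-- Gives stability of sets of exponents cut out by degrees that partners share. -/
theorem WeightPairing.weight_replace_of_invariant {τ : Type*} (P : WeightPairing τ) {w : τ → ℕ}
    (hw : ∀ t, w (P.partner t) = w t) {d : τ →₀ ℕ} {t : τ} (ht : d t ≠ 0) :
    Finsupp.weight w (d - Finsupp.single t 1 + Finsupp.single (P.partner t) 1) =
      Finsupp.weight w d := by
  rw [map_add, Finsupp.weight_single, hw, one_smul, Finsupp.weight_sub_single_add ht]

theorem weightedHomogeneousSubmodule_eq_restrictSupport {τ : Type*} (w : τ → ℕ) (j : ℕ) :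
    weightedHomogeneousSubmodule ℂ w j = restrictSupport ℂ {d | Finsupp.weight w d = j} := by
  ext F
  simp [mem_weightedHomogeneousSubmodule, IsWeightedHomogeneous, mem_restrictSupport_iff,
    Set.subset_def]

theorem ncard_eq_sum_fiber {α β : Type*} [DecidableEq β] {S : Set α} (hS : S.Finite) (f : α → β)
    (t : Finset β) (h : ∀ a ∈ S, f a ∈ t) :
    S.ncard = ∑ b ∈ t, {a | a ∈ S ∧ f a = b}.ncard := by
  classical
  rw [Set.ncard_eq_toFinset_card S hS,
    Finset.card_eq_sum_card_fiberwise (f := f) (t := t) (by intro a ha; exact h a (by simpa using ha))]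
  refine Finset.sum_congr rfl fun b _ => ?_
  rw [← Set.ncard_coe_finset]
  congr 1
  ext a
  simp

theorem ncard_degree_eq (n p : ℕ) :
    {a : Fin n →₀ ℕ | ∑ i, a i = p}.ncard = n.multichoose p := by
  have := Finset.card_finsuppAntidiag_nat_eq_multichoose (s := (Finset.univ : Finset (Fin n))) p
  rw [Finset.card_univ, Fintype.card_fin] at this
  rw [← this, ← Set.ncard_coe_finset]
  congr 1
  ext a
  simp [Finset.mem_finsuppAntidiag]

/-- The exponents of the coefficients of index `s` in a monomial in the coefficients of `n`
forms. -/
noncomputable def column {n : ℕ} (s : Fin 2) (d : Fin n × Fin 2 →₀ ℕ) : Fin n →₀ ℕ :=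
  Finsupp.equivFunOnFinite.symm fun i => d (i, s)

theorem column_bijective (n : ℕ) :
    Function.Bijective fun d : Fin n × Fin 2 →₀ ℕ => (column 0 d, column 1 d) := by
  constructor
  · intro d d' h
    simp only [Prod.mk.injEq] at h
    ext ⟨i, s⟩
    fin_cases s
    · exact DFunLike.congr_fun h.1 i
    · exact DFunLike.congr_fun h.2 i
  · rintro ⟨a, b⟩
    refine ⟨Finsupp.equivFunOnFinite.symm fun p => if p.2 = 0 then a p.1 else b p.1, ?_⟩
    ext i <;> simp [column]

/-- The degree of a monomial in the coefficients of index `s`. -/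
noncomputable def columnDegree {n : ℕ} (s : Fin 2) (d : Fin n × Fin 2 →₀ ℕ) : ℕ := ∑ i, d (i, s)

theorem ncard_columnDegree (n p q : ℕ) :
    {d : Fin n × Fin 2 →₀ ℕ | columnDegree 0 d = p ∧ columnDegree 1 d = q}.ncard =
      n.multichoose p * n.multichoose q := by
  rw [← ncard_degree_eq n p, ← ncard_degree_eq n q, ← Set.ncard_prod,
    ← Set.ncard_preimage_of_injective_subset_range (column_bijective n).1
      (by rw [(column_bijective n).2.range_eq]; exact Set.subset_univ _)]
  rfl

theorem weight_forms {n : ℕ} (d : Fin n × Fin 2 →₀ ℕ) :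
    Finsupp.weight (formsPairing n).wt d = (columnDegree 0 d : ℤ) - columnDegree 1 d := by
  rw [Finsupp.weight_eq_sum, Fintype.sum_prod_type]
  simp [Fin.sum_univ_two, formsPairing, columnDegree, Finset.sum_add_distrib, sub_eq_add_neg]

theorem weight_one_forms {n : ℕ} (d : Fin n × Fin 2 →₀ ℕ) :
    Finsupp.weight (1 : Fin n × Fin 2 → ℕ) d = columnDegree 0 d + columnDegree 1 d := by
  rw [Finsupp.weight_eq_sum, Fintype.sum_prod_type]
  simp [Fin.sum_univ_two, columnDegree, Finset.sum_add_distrib]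

theorem invariantsOfDegree_eq (n j : ℕ) :
    invariantsOfDegree n j = (formsPairing n).invariants ⊓
      restrictSupport ℂ {d : Fin n × Fin 2 →₀ ℕ | Finsupp.weight (1 : Fin n × Fin 2 → ℕ) d = j} := by
  rw [invariantsOfDegree, jointInvariants_eq, ← weightedHomogeneousSubmodule_eq_restrictSupport]
  rfl

theorem finite_weight_one_eq (n j : ℕ) :
    {d : Fin n × Fin 2 →₀ ℕ | Finsupp.weight (1 : Fin n × Fin 2 → ℕ) d = j}.Finite :=
  Finsupp.finite_of_nat_weight_eq _ (by simp) _

theorem finrank_invariantsOfDegree_add (n j : ℕ) :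
    Module.finrank ℂ (invariantsOfDegree n j) +
        {d : Fin n × Fin 2 →₀ ℕ | columnDegree 0 d + columnDegree 1 d = j ∧
          (columnDegree 0 d : ℤ) - columnDegree 1 d = 2}.ncard =
      {d : Fin n × Fin 2 →₀ ℕ | columnDegree 0 d + columnDegree 1 d = j ∧
          (columnDegree 0 d : ℤ) - columnDegree 1 d = 0}.ncard := by
  have := (formsPairing n).finrank_invariants_inf
    (S := {d : Fin n × Fin 2 →₀ ℕ | Finsupp.weight (1 : Fin n × Fin 2 → ℕ) d = j})
    (by
      intro d hd t ht
      have := (formsPairing n).weight_replace_of_invariant (w := 1) (fun _ => rfl) ht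
      exact this.trans hd)
    (finite_weight_one_eq n j)
  rw [← invariantsOfDegree_eq] at this
  simpa only [Set.mem_ofPred_eq, weight_forms, weight_one_forms] using this

theorem finrank_invariantsOfDegree_odd (n e : ℕ) :
    Module.finrank ℂ (invariantsOfDegree n (2 * e + 1)) = 0 := by
  have := finrank_invariantsOfDegree_add n (2 * e + 1)
  have h0 : {d : Fin n × Fin 2 →₀ ℕ | columnDegree 0 d + columnDegree 1 d = 2 * e + 1 ∧
      (columnDegree 0 d : ℤ) - columnDegree 1 d = 0} = ∅ := by
    ext d
    simp only [Set.mem_ofPred_eq, Set.mem_empty_iff_false, iff_false]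
    omega
  rw [h0, Set.ncard_empty] at this
  omega

/-- In degree `2 * (e + 1)`, weight 0 means column degrees `(e + 1, e + 1)` and weight 2 means `(e +
2, e)`. -/
theorem finrank_invariantsOfDegree_even (n e : ℕ) :
    Module.finrank ℂ (invariantsOfDegree n (2 * (e + 1))) +
      n.multichoose (e + 2) * n.multichoose e = n.multichoose (e + 1) ^ 2 := by
  have := finrank_invariantsOfDegree_add n (2 * (e + 1))
  rw [sq, ← ncard_columnDegree, ← ncard_columnDegree]
  convert this using 3
  all_goals
    try congr 1
    ext d
    constructor <;> rintro ⟨h1, h2⟩ <;> constructor <;> omega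

theorem finrank_invariantsOfDegree_zero (n : ℕ) :
    Module.finrank ℂ (invariantsOfDegree n 0) = 1 := by
  have := finrank_invariantsOfDegree_add n 0
  have h2 : {d : Fin n × Fin 2 →₀ ℕ | columnDegree 0 d + columnDegree 1 d = 0 ∧
      (columnDegree 0 d : ℤ) - columnDegree 1 d = 2} = ∅ := by
    ext d
    simp only [Set.mem_ofPred_eq, Set.mem_empty_iff_false, iff_false]
    omega
  have h0 : {d : Fin n × Fin 2 →₀ ℕ | columnDegree 0 d + columnDegree 1 d = 0 ∧
      (columnDegree 0 d : ℤ) - columnDegree 1 d = 0} =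
      {d | columnDegree 0 d = 0 ∧ columnDegree 1 d = 0} := by
    ext d; simp only [Set.mem_ofPred_eq]; omega
  rw [h0, h2, ncard_columnDegree] at this
  simpa using this

/-- The weights for the degree in the coefficients of the forms. -/
abbrev formsWeight (n : ℕ) : (Fin n × Fin 2) ⊕ Fin 2 → ℕ := Sum.elim (fun _ => 1) fun _ => 0

/-- The weights for the degree in the coordinates of the vector. -/
abbrev vecWeight (n : ℕ) : (Fin n × Fin 2) ⊕ Fin 2 → ℕ := Sum.elim (fun _ => 0) fun _ => 1

/-- The exponents of degree `j` in the forms and of degree at most `K` in the vector. -/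
def boundedExponents (n j K : ℕ) : Set ((Fin n × Fin 2) ⊕ Fin 2 →₀ ℕ) :=
  {d | Finsupp.weight (formsWeight n) d = j ∧ Finsupp.weight (vecWeight n) d ≤ K}

/-- The part of an exponent that belongs to the forms. -/
noncomputable def formsPart {n : ℕ} (d : (Fin n × Fin 2) ⊕ Fin 2 →₀ ℕ) : Fin n × Fin 2 →₀ ℕ :=
  Finsupp.equivFunOnFinite.symm fun p => d (.inl p)

theorem formsPart_bijective (n : ℕ) :
    Function.Bijective fun d : (Fin n × Fin 2) ⊕ Fin 2 →₀ ℕ =>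
      (formsPart d, (d (.inr 0), d (.inr 1))) := by
  constructor
  · intro d d' h
    simp only [Prod.mk.injEq] at h
    ext (p | s)
    · exact DFunLike.congr_fun h.1 p
    · fin_cases s
      · exact h.2.1
      · exact h.2.2
  · rintro ⟨a, r, s⟩
    refine ⟨Finsupp.equivFunOnFinite.symm (Sum.elim a fun i => if i = 0 then r else s), ?_⟩
    simp only [Finsupp.equivFunOnFinite_symm_apply_apply, Prod.mk.injEq]
    refine ⟨?_, by simp, by simp⟩
    ext p
    simp [formsPart]

theorem weight_formsVec {n : ℕ} (d : (Fin n × Fin 2) ⊕ Fin 2 →₀ ℕ) :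
    Finsupp.weight (formsVecPairing n).wt d =
      (columnDegree 0 (formsPart d) : ℤ) - columnDegree 1 (formsPart d) + d (.inr 1)
        - d (.inr 0) := by
  have := weight_forms (formsPart d)
  rw [Finsupp.weight_eq_sum] at this ⊢
  rw [Fintype.sum_sum_type, ← this, Fin.sum_univ_two]
  simp [formsPart, formsVecPairing]
  ring

theorem weight_formsWeight {n : ℕ} (d : (Fin n × Fin 2) ⊕ Fin 2 →₀ ℕ) :
    Finsupp.weight (formsWeight n) d =
      columnDegree 0 (formsPart d) + columnDegree 1 (formsPart d) := by
  have := weight_one_forms (formsPart d)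
  rw [Finsupp.weight_eq_sum] at this ⊢
  rw [Fintype.sum_sum_type, ← this]
  simp [formsPart]

theorem weight_vecWeight {n : ℕ} (d : (Fin n × Fin 2) ⊕ Fin 2 →₀ ℕ) :
    Finsupp.weight (vecWeight n) d = d (.inr 0) + d (.inr 1) := by
  rw [Finsupp.weight_eq_sum, Fintype.sum_sum_type, Fin.sum_univ_two]
  simp

theorem finite_boundedExponents (n j K : ℕ) : (boundedExponents n j K).Finite := by
  refine (Finsupp.finite_of_nat_weight_le (fun _ => 1) (by simp) (j + K)).subset ?_
  rintro d ⟨h1, h2⟩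
  have : Finsupp.weight (fun _ => 1 : (Fin n × Fin 2) ⊕ Fin 2 → ℕ) d =
      Finsupp.weight (formsWeight n) d + Finsupp.weight (vecWeight n) d := by
    simp [Finsupp.weight_eq_sum, Fintype.sum_sum_type]
  rw [Set.mem_ofPred_eq, this]
  omega

theorem isStable_boundedExponents (n j K : ℕ) :
    (formsVecPairing n).IsStable (boundedExponents n j K) := by
  rintro d ⟨h1, h2⟩ t ht
  constructor
  · rw [(formsVecPairing n).weight_replace_of_invariant _ ht, h1]
    rintro (p | s) <;> rfl
  · rw [(formsVecPairing n).weight_replace_of_invariant _ ht]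
    · exact h2
    · rintro (p | s) <;> rfl

/-- The monomials in two variables of degree at most `K` that complement the weight `p - q` to
`m`. -/
def complementaryExponents (K p q : ℕ) (m : ℤ) : Set (ℕ × ℕ) :=
  {x | x.1 + x.2 ≤ K ∧ (p : ℤ) - q + x.2 - x.1 = m}

theorem ncard_boundedExponents (n j K : ℕ) (m : ℤ) :
    {d | d ∈ boundedExponents n j K ∧ Finsupp.weight (formsVecPairing n).wt d = m}.ncard =
      ∑ x ∈ Finset.HasAntidiagonal.antidiagonal j, n.multichoose x.1 * n.multichoose x.2 *
        (complementaryExponents K x.1 x.2 m).ncard := by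
  rw [ncard_eq_sum_fiber ((finite_boundedExponents n j K).subset fun d hd => hd.1)
    (fun d => (columnDegree 0 (formsPart d), columnDegree 1 (formsPart d)))
    (Finset.HasAntidiagonal.antidiagonal j)]
  · refine Finset.sum_congr rfl fun x hx => ?_
    obtain ⟨p, q⟩ := x
    rw [Finset.HasAntidiagonal.mem_antidiagonal] at hx
    dsimp only at hx ⊢
    rw [← ncard_columnDegree, ← Set.ncard_prod,
      ← Set.ncard_preimage_of_injective_subset_range (formsPart_bijective n).1
        (by rw [(formsPart_bijective n).2.range_eq]; exact Set.subset_univ _)]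
    congr 1
    ext d
    simp only [Set.mem_ofPred_eq, boundedExponents, weight_formsVec, weight_formsWeight,
      weight_vecWeight, Set.mem_preimage, Set.mem_prod, complementaryExponents, Prod.mk.injEq]
    constructor
    · rintro ⟨⟨⟨h1, h2⟩, h3⟩, h4, h5⟩
      refine ⟨⟨h4, h5⟩, h2, ?_⟩
      rw [← h3, h4, h5]
    · rintro ⟨⟨h4, h5⟩, h2, h3⟩
      refine ⟨⟨⟨by omega, h2⟩, ?_⟩, h4, h5⟩
      rw [← h3, h4, h5]
  · rintro d ⟨⟨h1, -⟩, -⟩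
    rw [Finset.HasAntidiagonal.mem_antidiagonal, ← weight_formsWeight]
    exact h1

theorem ncard_complementaryExponents_zero {K p q : ℕ} (h : q ≤ p + K) :
    (complementaryExponents K p q 0).ncard = (K + p - q) / 2 + 1 - (p - q) := by
  have : complementaryExponents K p q 0 =
      (fun r => (r, r + q - p)) '' (Finset.Icc (p - q) ((K + p - q) / 2) : Set ℕ) := by
    ext ⟨r, s⟩
    simp only [complementaryExponents, Set.mem_ofPred_eq, Set.mem_image, Finset.coe_Icc,
      Set.mem_Icc, Prod.mk.injEq]
    constructor
    · intro hx
      exact ⟨r, by omega, rfl, by omega⟩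
    · rintro ⟨r, hr, rfl, rfl⟩
      omega
  rw [this, Set.ncard_image_of_injective _ fun a b hab => congrArg Prod.fst hab,
    Set.ncard_coe_finset, Nat.card_Icc]

theorem ncard_complementaryExponents_two {K p q : ℕ} (h : q ≤ p + K) :
    (complementaryExponents K p q 2).ncard = (K + p - q) / 2 - (p - (q + 2)) := by
  have : complementaryExponents K p q 2 =
      -- Compared with weight 0, the second exponent grows by 2, so `2 * r + 2 ≤ K + p - q`: the
      -- upper end of the interval is now excluded.
      (fun r => (r, r + 2 + q - p)) '' (Finset.Ico (p - (q + 2)) ((K + p - q) / 2) : Set ℕ) := by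
    ext ⟨r, s⟩
    simp only [complementaryExponents, Set.mem_ofPred_eq, Set.mem_image, Finset.coe_Ico,
      Set.mem_Ico, Prod.mk.injEq]
    constructor
    · intro hx
      exact ⟨r, by omega, rfl, by omega⟩
    · rintro ⟨r, hr, rfl, rfl⟩
      omega
  rw [this, Set.ncard_image_of_injective _ fun a b hab => congrArg Prod.fst hab,
    Set.ncard_coe_finset, Nat.card_Ico]

theorem finrank_invariants_boundedExponents {n j K : ℕ} (hK : j ≤ K) :
    Module.finrank ℂ ((formsVecPairing n).invariants ⊓
      restrictSupport ℂ (boundedExponents n j K) : Submodule ℂ _) =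
      ∑ x ∈ Finset.HasAntidiagonal.antidiagonal j, if x.2 = x.1 ∨ x.2 = x.1 + 1 then
        n.multichoose x.1 * n.multichoose x.2 else 0 := by
  have h := (formsVecPairing n).finrank_invariants_inf (isStable_boundedExponents n j K)
    (finite_boundedExponents n j K)
  rw [ncard_boundedExponents, ncard_boundedExponents] at h
  have h1 : ∑ x ∈ Finset.HasAntidiagonal.antidiagonal j, n.multichoose x.1 * n.multichoose x.2 *
        (complementaryExponents K x.1 x.2 0).ncard +
      ∑ x ∈ Finset.HasAntidiagonal.antidiagonal j, (if x.2 + 2 ≤ x.1 then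
        n.multichoose x.1 * n.multichoose x.2 else 0) =
      ∑ x ∈ Finset.HasAntidiagonal.antidiagonal j, n.multichoose x.1 * n.multichoose x.2 *
        (complementaryExponents K x.1 x.2 2).ncard +
      ∑ x ∈ Finset.HasAntidiagonal.antidiagonal j, (if x.1 ≤ x.2 then
        n.multichoose x.1 * n.multichoose x.2 else 0) := by
    rw [← Finset.sum_add_distrib, ← Finset.sum_add_distrib]
    refine Finset.sum_congr rfl fun x hx => ?_
    rw [Finset.HasAntidiagonal.mem_antidiagonal] at hx
    rw [ncard_complementaryExponents_zero (by omega), ncard_complementaryExponents_two (by omega)]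
    -- The number of complements to weight 0 minus that to weight 2 is `1` if `p ≤ q`, `-1` if `q +
    -- 2 ≤ p`, and `0` if `p = q + 1`, whatever `K` is. By the symmetry `p ↔ q` the pairs differing
    -- by at least 2 cancel, leaving `q = p` and `q = p + 1`.
    have : (K + x.1 - x.2) / 2 + 1 - (x.1 - x.2) + (if x.2 + 2 ≤ x.1 then 1 else 0) =
        (K + x.1 - x.2) / 2 - (x.1 - (x.2 + 2)) + (if x.1 ≤ x.2 then 1 else 0) := by
      split_ifs <;> omega
    have := congrArg (fun y => n.multichoose x.1 * n.multichoose x.2 * y) this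
    simpa only [mul_add, mul_ite, mul_one, mul_zero] using this
  have h2 : ∑ x ∈ Finset.HasAntidiagonal.antidiagonal j, (if x.2 + 2 ≤ x.1 then
        n.multichoose x.1 * n.multichoose x.2 else 0) =
      ∑ x ∈ Finset.HasAntidiagonal.antidiagonal j, (if x.1 + 2 ≤ x.2 then
        n.multichoose x.1 * n.multichoose x.2 else 0) := by
    rw [← Finset.Nat.sum_antidiagonal_swap]
    refine Finset.sum_congr rfl fun x _ => ?_
    simp only [Prod.fst_swap, Prod.snd_swap, mul_comm]
  have h3 : ∑ x ∈ Finset.HasAntidiagonal.antidiagonal j, (if x.1 ≤ x.2 then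
        n.multichoose x.1 * n.multichoose x.2 else 0) =
      ∑ x ∈ Finset.HasAntidiagonal.antidiagonal j, (if x.1 + 2 ≤ x.2 then
        n.multichoose x.1 * n.multichoose x.2 else 0) +
      ∑ x ∈ Finset.HasAntidiagonal.antidiagonal j, (if x.2 = x.1 ∨ x.2 = x.1 + 1 then
        n.multichoose x.1 * n.multichoose x.2 else 0) := by
    rw [← Finset.sum_add_distrib]
    refine Finset.sum_congr rfl fun x _ => ?_
    split_ifs <;> omega
  omega

/-- The order of a joint covariant is at most its degree. -/
theorem covariantsOfDegree_eq (n j : ℕ) :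
    covariantsOfDegree n j =
      (formsVecPairing n).invariants ⊓ restrictSupport ℂ (boundedExponents n j j) := by
  rw [covariantsOfDegree, jointCovariants_eq, weightedHomogeneousSubmodule_eq_restrictSupport]
  refine le_antisymm (fun F hF => ?_)
    (inf_le_inf_left _ (restrictSupport_mono _ fun d hd => hd.1))
  -- Any given covariant has some bounded order `K`. The cutoffs at `j` and at `max j K` give nested
  -- spaces of equal finite dimension, so they coincide.
  obtain ⟨K, hK⟩ := (F.support.image (Finsupp.weight (vecWeight n))).bddAbove
  have hle : (formsVecPairing n).invariants ⊓ restrictSupport ℂ (boundedExponents n j j) ≤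
      (formsVecPairing n).invariants ⊓ restrictSupport ℂ (boundedExponents n j (max j K)) :=
    inf_le_inf_left _ (restrictSupport_mono _ fun d hd => ⟨hd.1, hd.2.trans (le_max_left _ _)⟩)
  have := (formsVecPairing n).finiteDimensional_invariants_inf
    (finite_boundedExponents n j (max j K))
  rw [Submodule.eq_of_le_of_finrank_eq hle (by
    rw [finrank_invariants_boundedExponents le_rfl,
      finrank_invariants_boundedExponents (le_max_left _ _)])]
  refine ⟨hF.1, fun d hd => ⟨hF.2 hd, le_trans ?_ (le_max_right _ _)⟩⟩
  exact hK (Finset.mem_coe.2 (Finset.mem_image_of_mem _ hd))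

theorem finrank_covariantsOfDegree_even (n e : ℕ) :
    Module.finrank ℂ (covariantsOfDegree n (2 * e)) = n.multichoose e ^ 2 := by
  rw [covariantsOfDegree_eq, finrank_invariants_boundedExponents le_rfl,
    Finset.sum_eq_single (e, e)]
  · simp [sq]
  · rintro ⟨p, q⟩ hx hne
    rw [Finset.HasAntidiagonal.mem_antidiagonal] at hx
    rw [ne_eq, Prod.mk.injEq] at hne
    dsimp only at hx ⊢
    rw [if_neg (by omega)]
  · intro h
    exact absurd (Finset.HasAntidiagonal.mem_antidiagonal.2 (by ring)) h

theorem finrank_covariantsOfDegree_odd (n e : ℕ) :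
    Module.finrank ℂ (covariantsOfDegree n (2 * e + 1)) =
      n.multichoose e * n.multichoose (e + 1) := by
  rw [covariantsOfDegree_eq, finrank_invariants_boundedExponents le_rfl,
    Finset.sum_eq_single (e, e + 1)]
  · simp
  · rintro ⟨p, q⟩ hx hne
    rw [Finset.HasAntidiagonal.mem_antidiagonal] at hx
    rw [ne_eq, Prod.mk.injEq] at hne
    dsimp only at hx ⊢
    rw [if_neg (by omega)]
  · intro h
    exact absurd (Finset.HasAntidiagonal.mem_antidiagonal.2 (by ring)) h

theorem finiteDimensional_invariantsOfDegree (n j : ℕ) :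
    FiniteDimensional ℂ (invariantsOfDegree n j) := by
  rw [invariantsOfDegree_eq]
  exact (formsPairing n).finiteDimensional_invariants_inf (finite_weight_one_eq n j)

theorem finiteDimensional_covariantsOfDegree (n j : ℕ) :
    FiniteDimensional ℂ (covariantsOfDegree n j) := by
  rw [covariantsOfDegree_eq]
  exact (formsVecPairing n).finiteDimensional_invariants_inf (finite_boundedExponents n j j)

end

/-! ### Narayana polynomials and the Poincaré series. -/

open PowerSeries in
theorem evalSq_eq_expand (p : Polynomial ℚ) :
    evalSq p = PowerSeries.expand 2 two_ne_zero (p : PowerSeries ℚ) := by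
  induction p using Polynomial.induction_on' with
  | add p q hp hq =>
    have : evalSq (p + q) = evalSq p + evalSq q := map_add _ _ _
    rw [this, hp, hq, Polynomial.coe_add, map_add]
  | monomial k a =>
    have h : (monomial k a : PowerSeries ℚ) = a • X ^ k := by
      rw [X_pow_eq, ← map_smul, smul_eq_mul, mul_one]
    rw [evalSq, Polynomial.aeval_monomial, Polynomial.coe_monomial, h, map_smul, map_pow, expand_X,
      Algebra.smul_def]

theorem narayana_succ (m : ℕ) :
    narayana (m + 1) = ∑ k ∈ Finset.range (m + 1),
      Polynomial.C (((m + 1).choose k : ℚ) * (m.choose k : ℚ) / (k + 1)) * Polynomial.X ^ k := by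
  rw [narayana]
  refine Finset.sum_nbij' (· - 1) (· + 1) ?_ ?_ ?_ ?_ ?_
  · intro k hk; simp only [Finset.mem_Icc, Finset.mem_range] at *; omega
  · intro k hk; simp only [Finset.mem_Icc, Finset.mem_range] at *; omega
  · intro k hk; simp only [Finset.mem_Icc] at *; omega
  · intro k hk; simp
  · intro k hk
    rw [Finset.mem_Icc] at hk
    obtain ⟨l, rfl⟩ : ∃ l, k = l + 1 := ⟨k - 1, by omega⟩
    simp only [Nat.add_sub_cancel]
    congr 2
    push_cast
    ring

theorem coe_narayana_succ (m : ℕ) :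
    (narayana (m + 1) : PowerSeries ℚ) =
      PowerSeries.mk fun k => ((m + 1).choose k : ℚ) * (m.choose k : ℚ) / (k + 1) := by
  ext k
  rw [Polynomial.coeff_coe, PowerSeries.coeff_mk, narayana_succ, Polynomial.finsetSum_coeff]
  simp only [Polynomial.coeff_C_mul_X_pow]
  rw [Finset.sum_ite_eq]
  split_ifs with h
  · rfl
  · rw [Nat.choose_eq_zero_of_lt (n := m) (by simpa using h)]; simp

theorem coe_narayanaB (m : ℕ) :
    (narayanaB m : PowerSeries ℚ) =
      PowerSeries.mk fun k => (m.choose k : ℚ) * (m.choose k : ℚ) := by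
  ext k
  rw [Polynomial.coeff_coe, PowerSeries.coeff_mk, narayanaB, Polynomial.finsetSum_coeff]
  simp only [Polynomial.coeff_C_mul_X_pow]
  rw [Finset.sum_ite_eq]
  split_ifs with h
  · ring
  · rw [Nat.choose_eq_zero_of_lt (n := m) (by simpa using h)]; simp

theorem evalSq_narayana (m : ℕ) :
    evalSq (narayana m) = ∑ k ∈ Finset.Icc 1 m,
      PowerSeries.C ((1 / (k : ℚ)) * ((m - 1).choose (k - 1) : ℚ) * (m.choose (k - 1) : ℚ)) *
        (PowerSeries.X : PowerSeries ℚ) ^ (2 * k - 2) := by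
  rw [evalSq, narayana, map_sum]
  refine Finset.sum_congr rfl fun k hk => ?_
  rw [map_mul, map_pow, Polynomial.aeval_C, Polynomial.aeval_X, ← pow_mul, Nat.mul_sub]
  rfl

theorem evalSq_narayanaB (m : ℕ) :
    evalSq (narayanaB m) = ∑ k ∈ Finset.range (m + 1),
      PowerSeries.C ((m.choose k : ℚ) ^ 2) * (PowerSeries.X : PowerSeries ℚ) ^ (2 * k) := by
  rw [evalSq, narayanaB, map_sum]
  refine Finset.sum_congr rfl fun k hk => ?_
  rw [map_mul, map_pow _ Polynomial.X, Polynomial.aeval_C, Polynomial.aeval_X, ← pow_mul]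
  rfl

theorem natCast_mul_X_mul_evalSq_narayana (s : ℕ) :
    ((s + 2 : ℕ) : PowerSeries ℚ) * PowerSeries.X * evalSq (narayana (s + 1)) =
      ∑ k ∈ Finset.range (s + 1),
        PowerSeries.C ((s.choose k : ℚ) * ((s + 2).choose (k + 1) : ℚ)) *
          (PowerSeries.X : PowerSeries ℚ) ^ (2 * k + 1) := by
  rw [evalSq, narayana_succ, map_sum, Finset.mul_sum]
  refine Finset.sum_congr rfl fun k hk => ?_
  rw [map_mul, map_pow, Polynomial.aeval_C, Polynomial.aeval_X, ← pow_mul]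
  have h : (s.choose k : ℚ) * ((s + 2).choose (k + 1) : ℚ) =
      ((s + 2 : ℕ) : ℚ) * (((s + 1).choose k : ℚ) * (s.choose k : ℚ) / (k + 1)) := by
    have h1 : ((s + 2 : ℕ) : ℚ) * (s + 1).choose k = (s + 2).choose (k + 1) * ((k : ℚ) + 1) := by
      exact_mod_cast Nat.add_one_mul_choose_eq (s + 1) k
    have : (k : ℚ) + 1 ≠ 0 := by positivity
    field_simp
    linear_combination -(s.choose k : ℚ) * h1
  rw [h, map_mul, map_natCast, pow_succ]
  change _ * _ * (PowerSeries.C _ * _) = _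
  ring

theorem multichoose_succ_eq (m p : ℕ) : (m + 1).multichoose p = (p + m).choose m := by
  rw [Nat.multichoose_eq, show m + 1 + p - 1 = p + m by omega, Nat.choose_symm_add]

theorem poincareSeries_invariantsOfDegree (s : ℕ) :
    poincareSeries (invariantsOfDegree (s + 3)) = PowerSeries.expand 2 two_ne_zero
      (PowerSeries.mk fun e => ((e + (s + 1) + 1).choose (s + 1 + 1) : ℚ) *
        (e + s + 1).choose (s + 1) / (e + 1)) := by
  ext j
  rw [poincareSeries, PowerSeries.coeff_mk]
  obtain ⟨e, rfl | rfl⟩ := Nat.even_or_odd' j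
  · rw [PowerSeries.coeff_expand_mul, PowerSeries.coeff_mk]
    cases e with
    | zero => rw [mul_zero, finrank_invariantsOfDegree_zero]; simp
    | succ e =>
      have h := congrArg (Nat.cast (R := ℚ)) (finrank_invariantsOfDegree_even (s + 3) e)
      simp only [multichoose_succ_eq] at h
      have h1 := Nat.add_one_mul_choose_eq (e + (s + 2)) e
      have h2 := Nat.add_one_mul_choose_eq (e + 1 + (s + 2)) (e + 1)
      have h3 := choose_succ_cast (e + (s + 2)) (s + 1)
      have e1 : (e + (s + 2)).choose e = (e + (s + 2)).choose (s + 2) := Nat.choose_symm_add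
      have e2 : (e + (s + 2) + 1).choose (e + 1) = (e + 1 + (s + 2)).choose (s + 2) := by
        rw [add_right_comm]; exact Nat.choose_symm_add
      have e3 : (e + 1 + (s + 2)).choose (e + 1) = (e + 1 + (s + 2)).choose (s + 2) :=
        Nat.choose_symm_add
      have e4 : (e + 1 + (s + 2) + 1).choose (e + 1 + 1) = (e + 2 + (s + 2)).choose (s + 2) := by
        rw [show e + 1 + (s + 2) + 1 = e + 2 + (s + 2) by ring]; exact Nat.choose_symm_add
      have e5 : (e + (s + 2) + 1).choose (s + 1 + 1) = (e + 1 + (s + 2)).choose (s + 2) := by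
        rw [add_right_comm]
      rw [e1, e2] at h1
      rw [e3, e4] at h2
      rw [e5] at h3
      rw [show e + 1 + (s + 1) + 1 = e + 1 + (s + 2) by ring,
        show e + 1 + s + 1 = e + (s + 2) by ring, show s + 1 + 1 = s + 2 by ring]
      have h1' := congrArg (Nat.cast (R := ℚ)) h1
      have h2' := congrArg (Nat.cast (R := ℚ)) h2
      push_cast at h h1' h2' h3 ⊢
      have hne : (e : ℚ) + 1 + 1 ≠ 0 := by positivity
      rw [eq_div_iff hne]
      rw [show s + 1 + 1 = s + 2 by ring] at h3
      -- With `A0`, `A1`, `A2` three consecutive values of `multichoose`, the claim is `(e + 2) (A1²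
      -- - A2 A0) = A1 B`. The ratio relations `(e + s + 4) A1 = (e + 2) A2` and `(e + s + 3) A0 =
      -- (e + 1) A1` reduce it to Pascal's rule `A1 - A0 = B`.
      generalize ((e + 1 + (s + 2)).choose (s + 2) : ℚ) = A1 at *
      generalize ((e + 2 + (s + 2)).choose (s + 2) : ℚ) = A2 at *
      generalize ((e + (s + 2)).choose (s + 2) : ℚ) = A0 at *
      generalize ((e + (s + 2)).choose (s + 1) : ℚ) = B at *
      linear_combination (e + 2 : ℚ) * h + A0 * h2' - A1 * h1' + A1 * h3
  · rw [finrank_invariantsOfDegree_odd, PowerSeries.coeff_expand_of_not_dvd _ _ _ (by omega)]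
    simp

theorem poincareSeries_covariantsOfDegree (s : ℕ) :
    poincareSeries (covariantsOfDegree (s + 2)) =
      PowerSeries.expand 2 two_ne_zero (PowerSeries.mk fun e =>
        ((e + (s + 1)).choose (s + 1) : ℚ) * (e + (s + 1)).choose (s + 1)) +
      ((s + 2 : ℕ) : PowerSeries ℚ) * PowerSeries.X * PowerSeries.expand 2 two_ne_zero
        (PowerSeries.mk fun e => ((e + (s + 1) + 1).choose (s + 1 + 1) : ℚ) *
          (e + s + 1).choose (s + 1) / (e + 1)) := by
  ext j
  rw [poincareSeries, PowerSeries.coeff_mk, map_add, mul_assoc, ← map_natCast PowerSeries.C,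
    PowerSeries.coeff_C_mul]
  obtain ⟨e, rfl | rfl⟩ := Nat.even_or_odd' j
  · rw [PowerSeries.coeff_expand_mul, PowerSeries.coeff_mk, finrank_covariantsOfDegree_even,
      multichoose_succ_eq]
    have : PowerSeries.coeff (2 * e) (PowerSeries.X * PowerSeries.expand 2 two_ne_zero
        (PowerSeries.mk fun e => ((e + (s + 1) + 1).choose (s + 1 + 1) : ℚ) *
          (e + s + 1).choose (s + 1) / (e + 1))) = 0 := by
      cases e with
      | zero => simp
      | succ e =>
        rw [show 2 * (e + 1) = 2 * e + 1 + 1 by ring, PowerSeries.coeff_succ_X_mul,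
          PowerSeries.coeff_expand_of_not_dvd _ _ _ (by omega)]
    rw [this]
    push_cast
    ring
  · rw [PowerSeries.coeff_expand_of_not_dvd _ _ _ (by omega), PowerSeries.coeff_succ_X_mul,
      PowerSeries.coeff_expand_mul, PowerSeries.coeff_mk, finrank_covariantsOfDegree_odd,
      multichoose_succ_eq, multichoose_succ_eq]
    -- This trades `choose (s + 1)` for `choose (s + 2)`, producing the factor `n = s + 2` and the
    -- denominator `e + 1`.
    have h := succ_mul_choose_cast (e + (s + 1) + 1) (s + 1)
    rw [show e + 1 + (s + 1) = e + (s + 1) + 1 by ring, show e + s + 1 = e + (s + 1) by ring]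
    have hne : (e : ℚ) + 1 ≠ 0 := by positivity
    push_cast at *
    field_simp
    linear_combination (-((e + (s + 1)).choose (s + 1) : ℚ)) * h

theorem constantCoeff_one_sub_X_sq_pow (N : ℕ) :
    PowerSeries.constantCoeff ((1 - (PowerSeries.X : PowerSeries ℚ) ^ 2) ^ N) ≠ 0 := by
  simp

theorem expand_mul_one_sub_X_sq_pow {G Q : PowerSeries ℚ} {N : ℕ}
    (h : G * (1 - PowerSeries.X) ^ N = Q) :
    PowerSeries.expand 2 two_ne_zero G * (1 - (PowerSeries.X : PowerSeries ℚ) ^ 2) ^ N =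
      PowerSeries.expand 2 two_ne_zero Q := by
  rw [← h, map_mul, map_pow, map_sub, map_one, PowerSeries.expand_X]

theorem poincareSeries_invariants_eq (s : ℕ) :
    poincareSeries (invariantsOfDegree (s + 3)) = evalSq (narayana (s + 1)) *
      ((1 - (PowerSeries.X : PowerSeries ℚ) ^ 2) ^ (2 * s + 3))⁻¹ := by
  rw [PowerSeries.eq_mul_inv_iff_mul_eq (constantCoeff_one_sub_X_sq_pow _),
    poincareSeries_invariantsOfDegree, evalSq_eq_expand, coe_narayana_succ,
    ← mk_choose_mul_choose_div]
  refine expand_mul_one_sub_X_sq_pow ?_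
  congr 2
  ring

theorem poincareSeries_covariants_eq (s : ℕ) :
    poincareSeries (covariantsOfDegree (s + 2)) =
      (evalSq (narayanaB (s + 1)) +
        ((s + 2 : ℕ) : PowerSeries ℚ) * PowerSeries.X * evalSq (narayana (s + 1))) *
      ((1 - (PowerSeries.X : PowerSeries ℚ) ^ 2) ^ (2 * s + 3))⁻¹ := by
  rw [PowerSeries.eq_mul_inv_iff_mul_eq (constantCoeff_one_sub_X_sq_pow _),
    poincareSeries_covariantsOfDegree, evalSq_eq_expand, coe_narayanaB,
    evalSq_eq_expand, coe_narayana_succ, add_mul, mul_assoc _ (PowerSeries.expand _ _ _)]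
  congr 2
  · refine expand_mul_one_sub_X_sq_pow ?_
    rw [← mk_choose_mul_choose]
    congr 2
    ring
  · refine expand_mul_one_sub_X_sq_pow ?_
    rw [← mk_choose_mul_choose_div]
    congr 2
    ring

end BinaryForms

theorem theorem1 (n : ℕ) :
    -- all graded components are finite-dimensional
    (∀ j : ℕ, FiniteDimensional ℂ (BinaryForms.invariantsOfDegree n j)) ∧
    (∀ j : ℕ, FiniteDimensional ℂ (BinaryForms.covariantsOfDegree n j)) ∧
    -- (i), with explicit coefficients and through the Narayana polynomial
    (3 ≤ n →
      BinaryForms.poincareSeries (BinaryForms.invariantsOfDegree n) =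
        (∑ k ∈ Finset.Icc 1 (n - 2),
          PowerSeries.C ((1 / (k : ℚ)) * ((n - 3).choose (k - 1) : ℚ) *
            ((n - 2).choose (k - 1) : ℚ)) * (PowerSeries.X : PowerSeries ℚ) ^ (2 * k - 2)) *
          ((1 - (PowerSeries.X : PowerSeries ℚ) ^ 2) ^ (2 * n - 3))⁻¹ ∧
      BinaryForms.poincareSeries (BinaryForms.invariantsOfDegree n) =
        BinaryForms.evalSq (BinaryForms.narayana (n - 2)) *
          ((1 - (PowerSeries.X : PowerSeries ℚ) ^ 2) ^ (2 * n - 3))⁻¹) ∧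
    -- (ii), with explicit coefficients and through the Narayana polynomials
    (2 ≤ n →
      BinaryForms.poincareSeries (BinaryForms.covariantsOfDegree n) =
        ((∑ k ∈ Finset.range n,
            PowerSeries.C (((n - 1).choose k : ℚ) ^ 2) *
              (PowerSeries.X : PowerSeries ℚ) ^ (2 * k)) +
          ∑ k ∈ Finset.range (n - 1),
            PowerSeries.C (((n - 2).choose k : ℚ) * (n.choose (k + 1) : ℚ)) *
              (PowerSeries.X : PowerSeries ℚ) ^ (2 * k + 1)) *
          ((1 - (PowerSeries.X : PowerSeries ℚ) ^ 2) ^ (2 * n - 1))⁻¹ ∧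
      BinaryForms.poincareSeries (BinaryForms.covariantsOfDegree n) =
        (BinaryForms.evalSq (BinaryForms.narayanaB (n - 1)) +
          (n : PowerSeries ℚ) * PowerSeries.X *
            BinaryForms.evalSq (BinaryForms.narayana (n - 1))) *
          ((1 - (PowerSeries.X : PowerSeries ℚ) ^ 2) ^ (2 * n - 1))⁻¹) := by
  refine ⟨BinaryForms.finiteDimensional_invariantsOfDegree n,
    BinaryForms.finiteDimensional_covariantsOfDegree n, fun hn => ?_, fun hn => ?_⟩
  · obtain ⟨s, rfl⟩ : ∃ s, n = s + 3 := ⟨n - 3, by omega⟩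
    have h := BinaryForms.poincareSeries_invariants_eq s
    rw [show 2 * (s + 3) - 3 = 2 * s + 3 by omega, show s + 3 - 2 = s + 1 by omega]
    refine ⟨?_, h⟩
    rw [h, BinaryForms.evalSq_narayana]
    rfl
  · obtain ⟨s, rfl⟩ : ∃ s, n = s + 2 := ⟨n - 2, by omega⟩
    have h := BinaryForms.poincareSeries_covariants_eq s
    rw [show 2 * (s + 2) - 1 = 2 * s + 3 by omega, show s + 2 - 1 = s + 1 by omega]
    refine ⟨?_, h⟩
    rw [h, BinaryForms.evalSq_narayanaB, BinaryForms.natCast_mul_X_mul_evalSq_narayana]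
    rfl
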